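/- Let $\mathcal{S}$ be the mod-2 Steenrod algebra, i.e. the quotient of the free associative unital $\mathbb{F}_2$-algebra on symbols $Sq^0, Sq^1, Sq^2,\dots$ by $Sq^0=1$ and the Adem relations. Let $\langle Sq^1\rangle\subset\mathcal{S}$ be the two-sided ideal generated by $Sq^1$, and define $Q_0=Sq^1$ and $Q_{n+1}=Sq^{2^{n+1}}Q_n+Q_nSq^{2^{n+1}}$ for $n\ge 0$. Let $A=\bigoplus_{n\ge 0}A^n$ be an unstable algebra: a commutative graded unital $\mathbb{F}_2$-algebra with a left $\mathcal{S}$-module structure such that $Sq^i(A^n)\subset A^{n+i}$, $Sq^i x=0$ for $x\in A^n$ with $i>n$, $Sq^n x=x^2$ for $x\in A^n$, and $Sq^k(xy)=\sum_{i+j=k}Sq^i(x)\,Sq^j(y)$ for all $x,y\in A$. Let $\tilde{\mathcal{O}}A$ be the subalgebra of all elements of the even part $\bigoplus_n A^{2n}$ that are killed by every element of $\langle Sq^1\rangle$. (1) If $x\in A$ is homogeneous of even degree, then $x\in\tilde{\mathcal{O}}A$ if and only if $Q_i(x)=0$ for all $i\ge 0$. (2) More generally, for every $x\in A$ (of even degree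 or not, homogeneous or not), $Q_i(x)=0$ for all $i\ge 0$ if and only if $\theta(x)=0$ for all $\theta\in\langle Sq^1\rangle$. -/

import Mathlib

/-- The defining relations of the mod 2 Steenrod algebra, imposed on the free associative unital
`𝔽₂`-algebra on symbols `Sq^0, Sq^1, Sq^2, …`: `Sq^0 = 1`, and the Adem relations
`Sq^a Sq^b = ∑_{j = 0}^{⌊a/2⌋} C(b - 1 - j, a - 2j) Sq^{a + b - j} Sq^j` for `0 < a < 2b`
(in this range no natural-number subtraction below is truncated). -/
inductive SteenrodRel : FreeAlgebra (ZMod 2) ℕ → FreeAlgebra (ZMod 2) ℕ → Prop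
  | sq_zero : SteenrodRel (FreeAlgebra.ι (ZMod 2) 0) 1
  | adem (a b : ℕ) (ha : 0 < a) (hab : a < 2 * b) :
      SteenrodRel (FreeAlgebra.ι (ZMod 2) a * FreeAlgebra.ι (ZMod 2) b)
        (∑ j ∈ Finset.range (a / 2 + 1),
          (((b - 1 - j).choose (a - 2 * j) : ℕ) : ZMod 2) •
            (FreeAlgebra.ι (ZMod 2) (a + b - j) * FreeAlgebra.ι (ZMod 2) j))

/-- The mod 2 Steenrod algebra. -/
abbrev SteenrodAlgebra : Type := RingQuot SteenrodRel

namespace SteenrodAlgebra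

/-- The Steenrod square `Sq^i`, as an element of the Steenrod algebra. -/
noncomputable def Sq (i : ℕ) : SteenrodAlgebra :=
  RingQuot.mkAlgHom (ZMod 2) SteenrodRel (FreeAlgebra.ι (ZMod 2) i)

/-- The Milnor elements: `Q_0 = Sq^1` and
`Q_{n+1} = Sq^{2^{n+1}} Q_n + Q_n Sq^{2^{n+1}}`. -/
noncomputable def Q : ℕ → SteenrodAlgebra
  | 0 => Sq 1
  | n + 1 => Sq (2 ^ (n + 1)) * Q n + Q n * Sq (2 ^ (n + 1))

/-- The two-sided ideal `⟨Sq^1⟩` of the Steenrod algebra. -/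
noncomputable def sqOneIdeal : TwoSidedIdeal SteenrodAlgebra :=
  TwoSidedIdeal.span {Sq 1}

end SteenrodAlgebra

open SteenrodAlgebra in
/-- Let `A` be a commutative `𝔽₂`-algebra graded by the natural numbers, and a left module over
the Steenrod algebra. It is an unstable algebra if `Sq^i` raises degrees by `i`, the instability
condition `Sq^i x = 0` for `i > |x|` holds, `Sq^{|x|} x = x²`, and the Cartan formula holds.
(The two `𝔽₂`-linear structures on `A` agree automatically.) -/
class IsUnstableAlgebra {A : Type*} [CommRing A] [Algebra (ZMod 2) A]
    (𝒜 : ℕ → Submodule (ZMod 2) A) [GradedAlgebra 𝒜] [Module SteenrodAlgebra A] : Prop where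
  sq_smul_mem : ∀ (i n : ℕ) (x : A), x ∈ 𝒜 n → Sq i • x ∈ 𝒜 (n + i)
  sq_smul_eq_zero : ∀ (i n : ℕ) (x : A), x ∈ 𝒜 n → n < i → Sq i • x = 0
  sq_smul_self : ∀ (n : ℕ) (x : A), x ∈ 𝒜 n → Sq n • x = x ^ 2
  cartan : ∀ (k : ℕ) (x y : A),
    Sq k • (x * y) = ∑ p ∈ Finset.HasAntidiagonal.antidiagonal k, (Sq p.1 • x) * (Sq p.2 • y)

namespace SteenrodAlgebra

theorem Sq_zero : Sq 0 = 1 := by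
  rw [Sq, RingQuot.mkAlgHom_rel (ZMod 2) SteenrodRel.sq_zero, map_one]

theorem smul_mem_of_sq_smul_mem {A : Type*} [AddCommGroup A] [Module SteenrodAlgebra A]
    (S : AddSubgroup A) (hS : ∀ (i : ℕ), ∀ x ∈ S, Sq i • x ∈ S) (θ : SteenrodAlgebra) :
    ∀ x ∈ S, θ • x ∈ S := by
  obtain ⟨w, rfl⟩ := RingQuot.mkAlgHom_surjective (ZMod 2) SteenrodRel θ
  induction w using FreeAlgebra.induction with
  | grade0 r =>
    intro x hx
    rw [AlgHom.commutes]
    obtain rfl | rfl : r = 0 ∨ r = 1 := by revert r; decide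
    · rw [map_zero, zero_smul]
      exact S.zero_mem
    · rwa [map_one, one_smul]
  | grade1 i => exact hS i
  | mul a b ha hb =>
    intro x hx
    rw [map_mul, mul_smul]
    exact ha _ (hb _ hx)
  | add a b ha hb =>
    intro x hx
    rw [map_add, add_smul]
    exact S.add_mem (ha _ hx) (hb _ hx)

/-- A subgroup that is stable under the Steenrod squares and killed by `Sq^1` is killed by the
two-sided ideal generated by `Sq^1`. -/
theorem sqOneIdeal_smul_eq_zero {A : Type*} [AddCommGroup A] [Module SteenrodAlgebra A]
    (S : AddSubgroup A) (hS : ∀ (i : ℕ), ∀ x ∈ S, Sq i • x ∈ S)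
    (h1 : ∀ x ∈ S, Sq 1 • x = 0) : ∀ θ ∈ sqOneIdeal, ∀ x ∈ S, θ • x = 0 := by
  let J : TwoSidedIdeal SteenrodAlgebra := TwoSidedIdeal.mk' {θ | ∀ x ∈ S, θ • x = 0}
    (by intro x _; simp)
    (by intro a b ha hb x hx; rw [add_smul, ha x hx, hb x hx, add_zero])
    (by intro a ha x hx; rw [neg_smul, ha x hx, neg_zero])
    (by intro a b hb x hx; rw [mul_smul, hb x hx, smul_zero])
    (by intro a b ha x hx; rw [mul_smul]
        exact ha _ (smul_mem_of_sq_smul_mem S hS b x hx))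
  have hJ : sqOneIdeal ≤ J := by
    refine TwoSidedIdeal.span_le.2 ?_
    rintro _ rfl
    exact (TwoSidedIdeal.mem_mk' _ _ _ _ _ _ _).2 h1
  intro θ hθ
  exact (TwoSidedIdeal.mem_mk' _ _ _ _ _ _ _).1 (hJ hθ)

theorem one_killed {A : Type*} [CommRing A] [Algebra (ZMod 2) A]
    (𝒜 : ℕ → Submodule (ZMod 2) A) [GradedAlgebra 𝒜] [Module SteenrodAlgebra A]
    [IsUnstableAlgebra 𝒜] : ∀ θ ∈ sqOneIdeal, θ • (1 : A) = 0 := by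
  have h0 : ∀ i, 0 < i → Sq i • (1 : A) = 0 := fun i hi =>
    IsUnstableAlgebra.sq_smul_eq_zero (𝒜 := 𝒜) i 0 1 SetLike.GradedOne.one_mem hi
  intro θ hθ
  refine sqOneIdeal_smul_eq_zero (AddSubgroup.zmultiples (1 : A)) ?_ ?_ θ hθ 1
    (AddSubgroup.mem_zmultiples _)
  · rintro i _ ⟨m, rfl⟩
    show Sq i • (m • (1 : A)) ∈ _
    rw [smul_comm]
    refine AddSubgroup.zsmul_mem _ ?_ m
    rcases Nat.eq_zero_or_pos i with rfl | hi
    · rw [Sq_zero, one_smul]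
      exact AddSubgroup.mem_zmultiples _
    · rw [h0 i hi]
      exact AddSubgroup.zero_mem _
  · rintro _ ⟨m, rfl⟩
    show Sq 1 • (m • (1 : A)) = 0
    rw [smul_comm, h0 1 one_pos, smul_zero]

theorem mul_killed {A : Type*} [CommRing A] [Algebra (ZMod 2) A]
    (𝒜 : ℕ → Submodule (ZMod 2) A) [GradedAlgebra 𝒜] [Module SteenrodAlgebra A]
    [IsUnstableAlgebra 𝒜] {x y : A} (hx : ∀ θ ∈ sqOneIdeal, θ • x = 0)
    (hy : ∀ θ ∈ sqOneIdeal, θ • y = 0) : ∀ θ ∈ sqOneIdeal, θ • (x * y) = 0 := by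
  let T : Set A := {z | ∃ u v : A, (∀ θ ∈ sqOneIdeal, θ • u = 0) ∧
    (∀ θ ∈ sqOneIdeal, θ • v = 0) ∧ u * v = z}
  have h1 : Sq 1 ∈ sqOneIdeal := TwoSidedIdeal.subset_span rfl
  intro θ hθ
  refine sqOneIdeal_smul_eq_zero (AddSubgroup.closure T) ?_ ?_ θ hθ (x * y)
    (AddSubgroup.subset_closure ⟨x, y, hx, hy, rfl⟩)
  · intro i z hz
    induction hz using AddSubgroup.closure_induction with
    | mem z hz =>
      obtain ⟨u, v, hu, hv, rfl⟩ := hz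
      rw [IsUnstableAlgebra.cartan (𝒜 := 𝒜)]
      refine AddSubgroup.sum_mem _ fun p _ => AddSubgroup.subset_closure ⟨_, _, ?_, ?_, rfl⟩
      · intro η hη
        rw [← mul_smul]
        exact hu _ (sqOneIdeal.mul_mem_right _ _ hη)
      · intro η hη
        rw [← mul_smul]
        exact hv _ (sqOneIdeal.mul_mem_right _ _ hη)
    | zero => rw [smul_zero]; exact AddSubgroup.zero_mem _
    | add a b _ _ ha hb => rw [smul_add]; exact AddSubgroup.add_mem _ ha hb
    | neg a _ ha => rw [smul_neg]; exact AddSubgroup.neg_mem _ ha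
  · intro z hz
    induction hz using AddSubgroup.closure_induction with
    | mem z hz =>
      obtain ⟨u, v, hu, hv, rfl⟩ := hz
      rw [IsUnstableAlgebra.cartan (𝒜 := 𝒜)]
      simp [Finset.Nat.antidiagonal_succ, hu _ h1, hv _ h1]
    | zero => rw [smul_zero]
    | add a b _ _ ha hb => rw [smul_add, ha, hb, add_zero]
    | neg a _ ha => rw [smul_neg, ha, neg_zero]

end SteenrodAlgebra

/-- The even part `⨁ₙ A^{2n}` of a graded algebra. -/
def evenPart {A : Type*} [CommRing A] [Algebra (ZMod 2) A]
    (𝒜 : ℕ → Submodule (ZMod 2) A) : Submodule (ZMod 2) A :=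
  ⨆ n : ℕ, 𝒜 (2 * n)

theorem one_mem_evenPart {A : Type*} [CommRing A] [Algebra (ZMod 2) A]
    (𝒜 : ℕ → Submodule (ZMod 2) A) [GradedAlgebra 𝒜] : (1 : A) ∈ evenPart 𝒜 := by
  have h : (1 : A) ∈ 𝒜 (2 * 0) := SetLike.GradedOne.one_mem (A := 𝒜)
  exact Submodule.mem_iSup_of_mem (p := fun n => 𝒜 (2 * n)) 0 h

open SteenrodAlgebra in
/-- The subalgebra `Õ A` of an unstable algebra `A`: all elements of the even part of `A` that
are killed by every element of the two-sided ideal `⟨Sq^1⟩`. -/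
def tildeO {A : Type*} [CommRing A] [Algebra (ZMod 2) A]
    (𝒜 : ℕ → Submodule (ZMod 2) A) [GradedAlgebra 𝒜] [Module SteenrodAlgebra A]
    [IsUnstableAlgebra 𝒜] : Subalgebra (ZMod 2) A where
  carrier := {x | x ∈ evenPart 𝒜 ∧ ∀ θ ∈ sqOneIdeal, θ • x = 0}
  zero_mem' := ⟨Submodule.zero_mem _, fun _ _ => smul_zero _⟩
  one_mem' := ⟨one_mem_evenPart 𝒜, one_killed 𝒜⟩
  add_mem' := fun hx hy => ⟨Submodule.add_mem _ hx.1 hy.1, fun θ hθ => by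
    rw [smul_add, hx.2 θ hθ, hy.2 θ hθ, add_zero]⟩
  mul_mem' := fun hx hy => ⟨by
    have h : evenPart 𝒜 * evenPart 𝒜 ≤ evenPart 𝒜 := by
      conv_lhs => rw [evenPart, Submodule.iSup_mul]
      refine iSup_le fun m => ?_
      rw [Submodule.mul_iSup]
      refine iSup_le fun n => Submodule.mul_le.2 fun a ha b hb => ?_
      refine Submodule.mem_iSup_of_mem (m + n) ?_
      rw [mul_add]
      exact SetLike.GradedMul.mul_mem ha hb
    exact h (Submodule.mul_mem_mul hx.1 hy.1), mul_killed 𝒜 hx.2 hy.2⟩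
  algebraMap_mem' := fun r => by
    obtain rfl | rfl : r = 0 ∨ r = 1 := by revert r; decide
    · exact ⟨by simp, fun _ _ => by simp⟩
    · refine ⟨?_, ?_⟩
      · simpa using one_mem_evenPart 𝒜
      · simpa using one_killed 𝒜

/-! The common kernel of the `Q i` is stable under every `Sq k`. This follows from Milnor's formula
`Q_mul_Sq` by induction on `k`, since `Q n * Sq k` differs from `Sq k * Q n` only by a term with a
smaller square on the right. That kernel is killed by `Q 0 = Sq 1`, hence by the ideal
(`sqOneIdeal_smul_eq_zero`). Conversely each `Q i` lies in the ideal. Milnor's formula is extracted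
from the Adem relations through generating functions. With `P(z) = ∑ Sq^i z^i`, they yield the
Bullett–Macdonald identity `P((s²+s)z) P(z) = P((1+s)z) P(s²z)`. Applying the derivation `z d/dz`,
for which `P ↦ z Sq^1 P`, or later the derivation `[·, Q n]`, for which `P ↦ z^N Q_{n+1} P` with `N
= 2^(n+1)`, gives a functional equation for the next commutator. Its solutions are so rigid that
`[P, Q_{n+1}] P⁻¹` is a single monomial. -/

/-! ### Binomial sums, and the Adem relations as a congruence of polynomials. -/

-- Binet's formula: the sums satisfy `f (n+2) = f (n+1) + w * f n` with `w = s² + s`, and `t² - t -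
-- w` has roots `1 + s` and `-s`, which differ by `1 + 2s`.
open Finset.HasAntidiagonal in
theorem one_add_two_mul_sum_choose {R : Type*} [CommRing R] (s : R) : ∀ n : ℕ,
    (1 + 2 * s) * ∑ p ∈ antidiagonal n, (p.1.choose p.2 : R) * (s ^ 2 + s) ^ p.2 =
      (1 + s) ^ (n + 1) - (-s) ^ (n + 1) := by
  refine Nat.twoStepInduction (by simp; ring) ?_ fun n h1 h2 => ?_
  · simp [Finset.Nat.antidiagonal_succ]; ring
  · have key : ∑ p ∈ antidiagonal (n + 2), (p.1.choose p.2 : R) * (s ^ 2 + s) ^ p.2 =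
        ∑ p ∈ antidiagonal (n + 1), (p.1.choose p.2 : R) * (s ^ 2 + s) ^ p.2 +
        (s ^ 2 + s) * ∑ p ∈ antidiagonal n, (p.1.choose p.2 : R) * (s ^ 2 + s) ^ p.2 := by
      generalize s ^ 2 + s = w
      rw [Finset.Nat.antidiagonal_succ_succ', Finset.Nat.antidiagonal_succ', Finset.mul_sum]
      simp only [Finset.sum_cons, Finset.sum_map, Function.Embedding.prodMap,
        Function.Embedding.coeFn_mk, Prod.map, Function.Embedding.refl_apply]
      simp only [Nat.succ_eq_add_one, Nat.choose_succ_succ, Nat.cast_add, add_mul,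
        Finset.sum_add_distrib, pow_succ]
      simp [mul_comm]
      simp [add_left_comm, add_comm, mul_assoc]
    rw [key, mul_add, h2, mul_left_comm, h1]
    ring

namespace SteenrodAlgebra
open Polynomial

theorem sum_choose_mul_pow (M : ℕ) :
    ∑ k ∈ Finset.range (M + 1), ((M - k).choose k : (ZMod 2)[X]) * (X ^ 2 + X) ^ k =
      (1 + X) ^ (M + 1) + X ^ (M + 1) := by
  have h := one_add_two_mul_sum_choose (X : (ZMod 2)[X]) M
  have h2 : (1 + 2 * X : (ZMod 2)[X]) = 1 := by
    linear_combination X * (CharTwo.two_eq_zero : (2 : (ZMod 2)[X]) = 0)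
  rw [h2, one_mul, CharTwo.neg_eq, CharTwo.sub_eq_add,
    Finset.Nat.sum_antidiagonal_eq_sum_range_succ_mk,
    ← Finset.sum_range_reflect] at h
  rw [← h]
  refine Finset.sum_congr rfl fun k hk => ?_
  have := Finset.mem_range.1 hk
  rw [show M + 1 - 1 - k = M - k by omega, show M - (M - k) = k by omega]

/-- Compares the coefficients of the single unknown `x (n - j)` on the two sides once the Adem
relations have been substituted. The exponent is `⌈2n/3⌉`, because `a < 2(n - a)` means `a <
⌈2n/3⌉`. -/
theorem X_pow_dvd_sub_sum_choose (n j : ℕ) (hj : j ≤ n) :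
    (X : (ZMod 2)[X]) ^ ((2 * n + 2) / 3) ∣ (1 + X) ^ (n - j) * X ^ (2 * j) -
      ∑ a ∈ Finset.range ((2 * n + 2) / 3),
        if 2 * j ≤ a then ((n - a - 1 - j).choose (a - 2 * j) : (ZMod 2)[X]) * (X ^ 2 + X) ^ a
        else 0 := by
  obtain ⟨m, hm⟩ : ∃ m, m = (2 * n + 2) / 3 := ⟨_, rfl⟩
  rw [← hm]
  -- If `n ≤ 3j` then `2j ≥ m`: the sum is empty and the power of `X` is already large enough.
  rcases le_or_gt n (3 * j) with h | h
  · rw [Finset.sum_eq_zero, sub_zero]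
    · exact (pow_dvd_pow _ (by omega)).mul_left _
    · intro a ha
      rw [if_neg]
      have := Finset.mem_range.1 ha
      omega
  · obtain ⟨M, hM⟩ : ∃ M, n = 3 * j + M + 1 := ⟨n - 3 * j - 1, by omega⟩
    obtain ⟨r, hr⟩ : ∃ r, m = 2 * j + r := ⟨m - 2 * j, by omega⟩
    rw [hr, Finset.sum_range_add, Finset.sum_eq_zero, zero_add]
    · have h1 : ∑ k ∈ Finset.range r,
          (if 2 * j ≤ 2 * j + k then ((n - (2 * j + k) - 1 - j).choose (2 * j + k - 2 * j) :
            (ZMod 2)[X]) * (X ^ 2 + X) ^ (2 * j + k) else 0) =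
          (X ^ 2 + X) ^ (2 * j) * ((1 + X) ^ (M + 1) + X ^ (M + 1)) := by
        rw [← sum_choose_mul_pow, Finset.mul_sum]
        refine (Finset.sum_congr rfl fun k hk => ?_).trans
          (Finset.sum_subset (Finset.range_subset_range.2 (by omega : r ≤ M + 1))
            fun k hk hk' => ?_)
        · rw [if_pos (by omega), show n - (2 * j + k) - 1 - j = M - k by omega,
            show 2 * j + k - 2 * j = k by omega]
          ring
        -- Here `k ≥ r` forces `2k > M`, so the added binomial coefficients vanish.
        · rw [Finset.mem_range] at hk hk'
          rw [Nat.choose_eq_zero_of_lt (by omega)]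
          simp
      rw [h1]
      have h2 : (X : (ZMod 2)[X]) ^ 2 + X = X * (1 + X) := by ring
      rw [h2, show n - j = 2 * j + (M + 1) by omega, mul_add, mul_pow, pow_add (1 + X)]
      refine ⟨-(X ^ (M + 1 - r) * (1 + X) ^ (2 * j)), ?_⟩
      have h3 : (X : (ZMod 2)[X]) ^ (M + 1) = X ^ r * X ^ (M + 1 - r) := by
        rw [← pow_add]; congr 1; omega
      rw [h3]
      ring
    · intro a ha
      rw [if_neg]
      have := Finset.mem_range.1 ha
      omega

/-- The Adem relations in degree `n`, for the values `x a` of a linear functional on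
`Sq^a Sq^(n-a)`, imply the Bullett–Macdonald identity up to order `2n/3`. -/
theorem X_pow_dvd_sum_add_sum (n : ℕ) (x : ℕ → ZMod 2)
    (hx : ∀ a b, a + b = n → a < 2 * b →
      x a = ∑ j ∈ Finset.range (a / 2 + 1), ((b - 1 - j).choose (a - 2 * j) : ZMod 2) * x (n - j)) :
    (X : (ZMod 2)[X]) ^ ((2 * n + 2) / 3) ∣ ∑ a ∈ Finset.range (n + 1), C (x a) * (X ^ 2 + X) ^ a +
      ∑ a ∈ Finset.range (n + 1), C (x a) * ((1 + X) ^ a * X ^ (2 * (n - a))) := by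
  obtain ⟨m, hm⟩ : ∃ m, m = (2 * n + 2) / 3 := ⟨_, rfl⟩
  have h1 : (X : (ZMod 2)[X]) ^ m ∣ ∑ a ∈ Finset.range (n + 1), C (x a) * (X ^ 2 + X) ^ a -
      ∑ a ∈ Finset.range m, C (x a) * (X ^ 2 + X) ^ a := by
    have hmn : Finset.range m ⊆ Finset.range (n + 1) := Finset.range_subset_range.2 (by omega)
    rw [← Finset.sum_sdiff hmn, add_sub_cancel_right]
    refine Finset.dvd_sum fun a ha => Dvd.dvd.mul_left ?_ _
    rw [Finset.mem_sdiff, Finset.mem_range, Finset.mem_range] at ha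
    refine (pow_dvd_pow X (by omega : m ≤ a)).trans (pow_dvd_pow_of_dvd ⟨X + 1, by ring⟩ _)
  have h2 : (X : (ZMod 2)[X]) ^ m ∣
      ∑ a ∈ Finset.range (n + 1), C (x a) * ((1 + X) ^ a * X ^ (2 * (n - a))) -
      ∑ a ∈ Finset.range m, C (x a) * (X ^ 2 + X) ^ a := by
    have e : ∑ a ∈ Finset.range m, C (x a) * (X ^ 2 + X) ^ a =
        ∑ j ∈ Finset.range (n + 1), C (x (n - j)) * ∑ a ∈ Finset.range m,
          if 2 * j ≤ a then ((n - a - 1 - j).choose (a - 2 * j) : (ZMod 2)[X]) * (X ^ 2 + X) ^ a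
          else 0 := by
      simp_rw [Finset.mul_sum]
      rw [Finset.sum_comm]
      refine Finset.sum_congr rfl fun a ha => ?_
      have ha' := Finset.mem_range.1 ha
      -- The bound `a < m` is exactly the range in which the Adem relation applies.
      rw [hx a (n - a) (by omega) (by omega), map_sum, Finset.sum_mul]
      refine (Finset.sum_congr rfl fun j hj => ?_).trans
        (Finset.sum_subset (Finset.range_subset_range.2 (by omega : a / 2 + 1 ≤ n + 1))
          fun j hj hj' => ?_)
      · rw [Finset.mem_range] at hj
        rw [if_pos (by omega), map_mul, map_natCast]
        ring
      · rw [Finset.mem_range] at hj hj'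
        rw [if_neg (by omega), mul_zero]
    rw [e, ← Finset.sum_range_reflect, ← Finset.sum_sub_distrib]
    refine Finset.dvd_sum fun j hj => ?_
    have hj' := Finset.mem_range.1 hj
    rw [show n + 1 - 1 - j = n - j by omega, show n - (n - j) = j by omega, ← mul_sub]
    refine Dvd.dvd.mul_left ?_ _
    rw [hm]
    exact X_pow_dvd_sub_sum_choose n j (by omega)
  have h3 := dvd_sub h1 h2
  rw [sub_sub_sub_cancel_right, CharTwo.sub_eq_add, hm] at h3
  exact h3

/-! ### Symmetry in `s`: from the congruence to an identity. -/

theorem reflect_sum {R ι : Type*} [Semiring R] (N : ℕ) (s : Finset ι) (f : ι → R[X]) :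
    reflect N (∑ i ∈ s, f i) = ∑ i ∈ s, reflect N (f i) := by
  classical
  induction s using Finset.induction_on with
  | empty => simp
  | insert i s hi ih => rw [Finset.sum_insert hi, Finset.sum_insert hi, reflect_add, ih]

theorem reflect_one_add_X_pow {R : Type*} [CommSemiring R] (n : ℕ) :
    reflect n ((1 + X : R[X]) ^ n) = (1 + X) ^ n := by
  have hd : (1 + X : R[X]).natDegree ≤ 1 := by
    exact natDegree_add_le_of_degree_le (by simp) natDegree_X_le
  induction n with
  | zero => simp
  | succ n ih =>
    rw [pow_succ, reflect_mul _ _ (by simpa using natDegree_pow_le_of_le n hd) hd, ih,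
      reflect_add, reflect_one_X, reflect_one, pow_one, add_comm X]

/-- The Adem relations imply the Bullett–Macdonald identity, for the values `x a` of a linear
functional on `Sq^a Sq^(n-a)`. -/
theorem sum_eq_sum_of_adem (n : ℕ) (x : ℕ → ZMod 2)
    (hx : ∀ a b, a + b = n → a < 2 * b →
      x a = ∑ j ∈ Finset.range (a / 2 + 1), ((b - 1 - j).choose (a - 2 * j) : ZMod 2) * x (n - j)) :
    ∑ a ∈ Finset.range (n + 1), C (x a) * (X ^ 2 + X) ^ a =
      ∑ a ∈ Finset.range (n + 1), C (x a) * ((1 + X) ^ a * X ^ (2 * (n - a))) := by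
  have hG := X_pow_dvd_sum_add_sum n x hx
  obtain ⟨m, hm⟩ : ∃ m, m = (2 * n + 2) / 3 := ⟨_, rfl⟩
  rw [← hm] at hG
  set F₁ := ∑ a ∈ Finset.range (n + 1), C (x a) * (X ^ 2 + X) ^ a with hF₁
  set F₂ := ∑ a ∈ Finset.range (n + 1), C (x a) * ((1 + X) ^ a * X ^ (2 * (n - a))) with hF₂
  set F₃ := ∑ a ∈ Finset.range (n + 1), C (x a) * (X ^ a * (1 + X) ^ (2 * (n - a))) with hF₃
  have hd : (1 + X : (ZMod 2)[X]).natDegree ≤ 1 := by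
    exact natDegree_add_le_of_degree_le (by simp) natDegree_X_le
  have h1 : (1 + X : (ZMod 2)[X]) ≠ 0 := by
    rw [add_comm, ← C_1]
    exact X_add_C_ne_zero _
  have h1d : (1 + X : (ZMod 2)[X]).natDegree = 1 := by
    rw [add_comm, ← C_1]
    exact natDegree_X_add_C _
  have hd' (a : ℕ) : ((1 + X : (ZMod 2)[X]) ^ a).natDegree ≤ a := by
    simpa using natDegree_pow_le_of_le a hd
  have hu : (X ^ 2 + X : (ZMod 2)[X]) = X * (1 + X) := by ring
  have hu' : ((1 + X) ^ 2 + (1 + X) : (ZMod 2)[X]) = X ^ 2 + X := by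
    linear_combination (1 + X) * (CharTwo.two_eq_zero : (2 : (ZMod 2)[X]) = 0)
  -- The involutions `s ↦ 1 + s` and `F ↦ s^(2n) F(1/s)` generate an action of `S₃` permuting `F₁,
  -- F₂, F₃`: the first fixes `F₁`, the second fixes `F₃`.
  have c1 : F₁.comp (1 + X) = F₁ := by
    simp only [hF₁, Polynomial.sum_comp, mul_comp, C_comp, pow_comp, add_comp, X_comp, hu']
  have c2 : F₂.comp (1 + X) = F₃ := by
    simp only [hF₂, hF₃, Polynomial.sum_comp, mul_comp, C_comp, pow_comp, add_comp, X_comp, one_comp]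
    refine Finset.sum_congr rfl fun a _ => ?_
    rw [CharTwo.add_cancel_left]
  have r1 : reflect (2 * n) F₁ = F₂ := by
    rw [hF₁, hF₂, reflect_sum]
    refine Finset.sum_congr rfl fun a ha => ?_
    have := Finset.mem_range.1 ha
    rw [reflect_C_mul, hu, mul_pow, show 2 * n = (a + a) + 2 * (n - a) by omega,
      ← mul_one (X ^ a * (1 + X) ^ a), reflect_mul _ _
        ((natDegree_mul_le_of_le (natDegree_X_pow_le a) (hd' a))) (by simp),
      reflect_mul _ _ (natDegree_X_pow_le a) (hd' a), reflect_one_add_X_pow, reflect_monomial,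
      reflect_one, revAt_le le_rfl]
    simp
  have r3 : reflect (2 * n) F₃ = F₃ := by
    rw [hF₃, reflect_sum]
    refine Finset.sum_congr rfl fun a ha => ?_
    have := Finset.mem_range.1 ha
    rw [reflect_C_mul, show 2 * n = 2 * a + 2 * (n - a) by omega, reflect_mul _ _
        ((natDegree_X_pow_le a).trans (by omega)) (hd' _), reflect_one_add_X_pow,
      reflect_monomial, revAt_le (by omega), show 2 * a - a = a by omega]
  have r2 : reflect (2 * n) F₂ = F₁ := by rw [← r1, reflect_reflect]
  have d1 : F₁.natDegree ≤ 2 * n := by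
    refine natDegree_sum_le_of_forall_le _ _ fun a ha => (natDegree_C_mul_le _ _).trans ?_
    have := Finset.mem_range.1 ha
    rw [hu, mul_pow]
    exact (natDegree_mul_le_of_le (natDegree_X_pow_le a) (hd' a)).trans (by omega)
  have d2 : F₂.natDegree ≤ 2 * n := by
    rw [← r1]; exact natDegree_reflect_le.trans (by simpa using d1)
  have d3 : F₃.natDegree ≤ 2 * n := by
    refine natDegree_sum_le_of_forall_le _ _ fun a ha => (natDegree_C_mul_le _ _).trans ?_
    have := Finset.mem_range.1 ha
    exact (natDegree_mul_le_of_le (natDegree_X_pow_le a) (hd' _)).trans (by omega)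
  have hmn : m ≤ 2 * n := by omega
  by_contra hne
  have hG0 : F₁ + F₂ ≠ 0 := fun h => hne (CharTwo.add_eq_zero.1 h)
  -- Vanishing to order `m` at `0` becomes, by reflection, vanishing to order `m` at infinity.
  have hdeg : (F₁ + F₂).natDegree ≤ 2 * n - m := by
    obtain ⟨K, hK⟩ := hG
    have hK0 : K ≠ 0 := by rintro rfl; simp [hK] at hG0
    have hKd : K.natDegree ≤ 2 * n - m := by
      have := (natDegree_add_le_of_degree_le d1 d2)
      rw [hK, natDegree_mul (by simp) hK0, natDegree_X_pow] at this
      omega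
    have hr : reflect (2 * n) (F₁ + F₂) = F₁ + F₂ := by rw [reflect_add, r1, r2, add_comm]
    rw [← hr, hK, show 2 * n = m + (2 * n - m) by omega,
      reflect_mul _ _ (natDegree_X_pow_le m) hKd, reflect_monomial, revAt_le le_rfl]
    simp only [Nat.sub_self, pow_zero, one_mul]
    exact natDegree_reflect_le.trans (by simpa using hKd)
  have hτ : (1 + X : (ZMod 2)[X]) ^ m ∣ F₁ + F₃ := by
    obtain ⟨K, hK⟩ := hG
    refine ⟨K.comp (1 + X), ?_⟩
    rw [← c1, ← c2, ← add_comp, hK, mul_comp, pow_comp, X_comp]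
  have hτσ : (1 + X : (ZMod 2)[X]) ^ m ∣ F₂ + F₃ := by
    obtain ⟨K, hK⟩ := hτ
    rcases eq_or_ne K 0 with rfl | hK0
    · rw [mul_zero] at hK
      rw [← r1, ← r3, ← reflect_add, hK, reflect_zero]
      exact dvd_zero _
    have hKd : K.natDegree ≤ 2 * n - m := by
      have := (natDegree_add_le_of_degree_le d1 d3)
      rw [hK, natDegree_mul (pow_ne_zero _ h1) hK0, natDegree_pow, h1d] at this
      omega
    refine ⟨reflect (2 * n - m) K, ?_⟩
    rw [← r1]
    nth_rewrite 1 [← r3]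
    rw [← reflect_add, hK]
    conv_lhs => rw [show 2 * n = m + (2 * n - m) by omega]
    rw [reflect_mul _ _ (hd' m) hKd, reflect_one_add_X_pow]
  have hsum : F₁ + F₂ = (F₁ + F₃) + (F₂ + F₃) := by
    rw [add_add_add_comm, CharTwo.add_self_eq_zero, add_zero]
  have hcop : IsCoprime ((X : (ZMod 2)[X]) ^ m) ((1 + X) ^ m) :=
    IsCoprime.pow ⟨-1, 1, by ring⟩
  obtain ⟨K, hK⟩ := hcop.mul_dvd hG (hsum ▸ dvd_add hτ hτσ)
  have hK0 : K ≠ 0 := by rintro rfl; simp [hK] at hG0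
  -- Zeros of order `m` at `0`, `1` and infinity need `3m ≤ 2n`, whereas `3m ≥ 2n`; only a constant
  -- multiple of `(X(1+X))^m` survives.
  have hKd : K.natDegree = 0 := by
    rw [hK, natDegree_mul (mul_ne_zero (by simp) (pow_ne_zero _ h1)) hK0,
      natDegree_mul (by simp) (pow_ne_zero _ h1), natDegree_pow, natDegree_pow, h1d,
      natDegree_X] at hdeg
    omega
  -- This borderline case is excluded by symmetry: invariance under `s ↦ 1 + s` gives `F₃ = F₂`, and
  -- reflecting gives `F₁ = F₂`.
  have hinv : (F₁ + F₂).comp (1 + X) = F₁ + F₂ := by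
    rw [hK, eq_C_of_natDegree_eq_zero hKd]
    simp only [mul_comp, C_comp, pow_comp, add_comp, X_comp, one_comp]
    rw [CharTwo.add_cancel_left]
    ring
  rw [add_comp, c1, c2] at hinv
  have h32 : F₃ = F₂ := add_left_cancel hinv
  exact hne (by rw [← r2, ← h32, r3])

end SteenrodAlgebra

/-! ### Rescaling and derivations of noncommutative power series. -/

section scaleSeries
open PowerSeries

/-- The substitution `z ↦ u z` of a central polynomial `u` into a power series. -/
noncomputable def scaleSeries {R : Type*} [Ring R] (u : Polynomial R)
    (hu : ∀ p, Commute u p) : R⟦X⟧ →+* (Polynomial R)⟦X⟧ where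
  toFun f := PowerSeries.mk fun i => Polynomial.C (coeff i f) * u ^ i
  map_zero' := by ext1 i; simp
  map_one' := by
    ext1 i
    rw [coeff_mk, coeff_one, coeff_one]
    split_ifs with h <;> simp [h]
  map_add' f g := by ext1 i; simp [add_mul]
  map_mul' f g := by
    ext1 n
    simp only [coeff_mk, coeff_mul, map_sum, Finset.sum_mul, map_mul]
    refine Finset.sum_congr rfl fun p hp => ?_
    rw [← Finset.HasAntidiagonal.mem_antidiagonal.1 hp, pow_add]
    simp only [mul_assoc]
    rw [← mul_assoc (Polynomial.C (coeff p.2 g)), ← ((hu _).pow_left p.1).eq, mul_assoc]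

theorem coeff_scaleSeries {R : Type*} [Ring R] (u : Polynomial R) (hu : ∀ p, Commute u p)
    (f : R⟦X⟧) (i : ℕ) : coeff i (scaleSeries u hu f) = Polynomial.C (coeff i f) * u ^ i := by
  simp [scaleSeries]

theorem scaleSeries_C {R : Type*} [Ring R] (u : Polynomial R) (hu : ∀ p, Commute u p) (r : R) :
    scaleSeries u hu (C r) = C (Polynomial.C r) := by
  ext1 i
  rw [coeff_scaleSeries, coeff_C, coeff_C]
  split_ifs with h <;> simp [h]

theorem scaleSeries_X_pow {R : Type*} [Ring R] (u : Polynomial R) (hu : ∀ p, Commute u p) (n : ℕ) :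
    scaleSeries u hu (X ^ n) = C (u ^ n) * X ^ n := by
  ext1 i
  rw [coeff_scaleSeries, coeff_C_mul, coeff_X_pow, coeff_X_pow]
  split_ifs with h <;> simp [h]

/-- The Euler derivation `z d/dz` of power series. -/
noncomputable def eulerDerivation {R : Type*} [Ring R] (f : R⟦X⟧) : R⟦X⟧ :=
  PowerSeries.mk fun n => n • coeff n f

theorem eulerDerivation_mul {R : Type*} [Ring R] (f g : R⟦X⟧) :
    eulerDerivation (f * g) = eulerDerivation f * g + f * eulerDerivation g := by
  ext1 n
  simp only [eulerDerivation, coeff_mk, coeff_mul, map_add, Finset.smul_sum,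
    ← Finset.sum_add_distrib]
  refine Finset.sum_congr rfl fun p hp => ?_
  rw [← Finset.HasAntidiagonal.mem_antidiagonal.1 hp, add_smul, smul_mul_assoc, mul_smul_comm]

theorem eulerDerivation_scaleSeries {R : Type*} [Ring R] (u : Polynomial R)
    (hu : ∀ p, Commute u p) (f : R⟦X⟧) :
    eulerDerivation (scaleSeries u hu f) = scaleSeries u hu (eulerDerivation f) := by
  ext1 n
  simp [eulerDerivation, coeff_scaleSeries, mul_assoc]

theorem commute_C_of_forall_commute {R : Type*} [Ring R] {u : R} (hu : ∀ r, Commute u r) (f : R⟦X⟧) :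
    Commute (C u) f := by
  ext1 n
  rw [coeff_C_mul, coeff_mul_C, (hu _).eq]

/-- Subtract `(c₁ + c₂) q p₁ p₂ = (c₃ + c₄) q p₃ p₄` from the differentiated relation `hd`. -/
theorem mul_commutator_mul_eq {W : Type*} [Ring W] {p₁ p₂ p₃ p₄ c₁ c₂ c₃ c₄ q : W}
    (h₂ : ∀ w, Commute c₂ w) (h₄ : ∀ w, Commute c₄ w) (hp : p₁ * p₂ = p₃ * p₄)
    (hd : c₁ * q * p₁ * p₂ + p₁ * (c₂ * q * p₂) = c₃ * q * p₃ * p₄ + p₃ * (c₄ * q * p₄))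
    (hc : c₁ + c₂ = c₃ + c₄) :
    c₂ * (p₁ * q - q * p₁) * p₂ = c₄ * (p₃ * q - q * p₃) * p₄ := by
  have e₁ : p₁ * (c₂ * q * p₂) = c₂ * p₁ * q * p₂ := by
    simp only [← mul_assoc, (h₂ p₁).eq]
  have e₂ : p₃ * (c₄ * q * p₄) = c₄ * p₃ * q * p₄ := by
    simp only [← mul_assoc, (h₄ p₃).eq]
  rw [e₁, e₂] at hd
  have e₃ : c₃ * q * p₃ * p₄ = c₃ * q * p₁ * p₂ := by
    rw [mul_assoc, ← hp, ← mul_assoc]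
  have e₄ : c₄ * q * p₃ * p₄ = c₄ * q * p₁ * p₂ := by
    rw [mul_assoc, ← hp, ← mul_assoc]
  have e₅ : c₁ * q * p₁ * p₂ + c₂ * q * p₁ * p₂ = c₃ * q * p₁ * p₂ + c₄ * q * p₁ * p₂ := by
    simp only [← add_mul, hc]
  simp only [mul_sub, sub_mul, ← mul_assoc]
  rw [e₄]
  rw [e₃] at hd
  rw [← add_sub_add_left_eq_sub _ _ (c₁ * q * p₁ * p₂), hd, e₅, add_sub_add_left_eq_sub]

end scaleSeries

/-! ### The total square, the Bullett–Macdonald identity and commutators with `Q n`. -/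

namespace SteenrodAlgebra
open PowerSeries

theorem Sq_mul_Sq (a b : ℕ) (ha : 0 < a) (hab : a < 2 * b) :
    Sq a * Sq b = ∑ j ∈ Finset.range (a / 2 + 1),
      (((b - 1 - j).choose (a - 2 * j) : ℕ) : ZMod 2) • (Sq (a + b - j) * Sq j) := by
  have := RingQuot.mkAlgHom_rel (ZMod 2) (SteenrodRel.adem a b ha hab)
  simp only [map_mul, map_sum, map_smul] at this
  exact this

theorem two_eq_zero : (2 : SteenrodAlgebra) = 0 := by
  rw [← map_ofNat (algebraMap (ZMod 2) SteenrodAlgebra) 2]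
  exact (congrArg _ (by decide)).trans (map_zero _)

theorem sub_eq_add (x y : SteenrodAlgebra) : x - y = x + y := by
  rw [sub_eq_iff_eq_add, add_assoc, ← two_mul, two_eq_zero, zero_mul, add_zero]

/-- The total Steenrod square `∑ Sq^i z^i`. -/
noncomputable def totalSq : SteenrodAlgebra⟦X⟧ := PowerSeries.mk Sq

theorem isUnit_totalSq : IsUnit totalSq := by
  rw [isUnit_iff_constantCoeff, totalSq, ← coeff_zero_eq_constantCoeff_apply, coeff_mk, Sq_zero]
  exact isUnit_one

theorem commute_one_add_X (p : Polynomial SteenrodAlgebra) : Commute (1 + Polynomial.X) p :=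
  (Commute.one_left p).add_left (Polynomial.commute_X p)

theorem commute_X_sq (p : Polynomial SteenrodAlgebra) : Commute (Polynomial.X ^ 2) p :=
  (Polynomial.commute_X p).pow_left 2

theorem commute_X_sq_add_X (p : Polynomial SteenrodAlgebra) :
    Commute (Polynomial.X ^ 2 + Polynomial.X) p :=
  (commute_X_sq p).add_left (Polynomial.commute_X p)

/-- Substitution of `(s² + s) z` for `z`. -/
noncomputable abbrev scale₁ := scaleSeries _ commute_X_sq_add_X
/-- The inclusion of power series as those that are constant in `s`. -/
noncomputable abbrev scale₂ := scaleSeries (1 : Polynomial SteenrodAlgebra) Commute.one_left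
/-- Substitution of `(1 + s) z` for `z`. -/
noncomputable abbrev scale₃ := scaleSeries _ commute_one_add_X
/-- Substitution of `s² z` for `z`. -/
noncomputable abbrev scale₄ := scaleSeries _ commute_X_sq

/-- Linear functionals separate points, which reduces the identity to polynomials over `ZMod 2`. -/
theorem sum_Sq_mul_Sq (n : ℕ) :
    ∑ a ∈ Finset.range (n + 1), Polynomial.C (Sq a * Sq (n - a)) *
      (Polynomial.X ^ 2 + Polynomial.X) ^ a =
    ∑ a ∈ Finset.range (n + 1), Polynomial.C (Sq a * Sq (n - a)) *
      ((1 + Polynomial.X) ^ a * Polynomial.X ^ (2 * (n - a))) := by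
  have hmap (p : ℕ → Polynomial (ZMod 2)) (φ : Module.Dual (ZMod 2) SteenrodAlgebra) (k : ℕ) :
      φ ((∑ a ∈ Finset.range (n + 1), Polynomial.C (Sq a * Sq (n - a)) *
        (p a).map (algebraMap (ZMod 2) SteenrodAlgebra)).coeff k) =
      (∑ a ∈ Finset.range (n + 1), Polynomial.C (φ (Sq a * Sq (n - a))) * p a).coeff k := by
    simp only [Polynomial.finsetSum_coeff, Polynomial.coeff_C_mul, Polynomial.coeff_map, map_sum]
    refine Finset.sum_congr rfl fun a _ => ?_
    rw [← Algebra.commutes, ← Algebra.smul_def, map_smul, smul_eq_mul, mul_comm]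
  ext k
  rw [← sub_eq_zero, ← Module.forall_dual_apply_eq_zero_iff (ZMod 2)]
  intro φ
  have h₁ := hmap (fun a => (Polynomial.X ^ 2 + Polynomial.X) ^ a) φ k
  have h₂ := hmap (fun a => (1 + Polynomial.X) ^ a * Polynomial.X ^ (2 * (n - a))) φ k
  simp only [Polynomial.map_mul, Polynomial.map_pow, Polynomial.map_add, Polynomial.map_X,
    Polynomial.map_one] at h₁ h₂
  rw [map_sub, h₁, h₂, sub_eq_zero, sum_eq_sum_of_adem n fun a => φ (Sq a * Sq (n - a))]
  intro a b hab h
  -- The case `a = 0` is not an Adem relation; it reads `Sq^0 Sq^n = Sq^n Sq^0`.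
  rcases Nat.eq_zero_or_pos a with rfl | ha
  · obtain rfl : b = n := by omega
    simp [Sq_zero]
  · rw [show n - a = b by omega, Sq_mul_Sq a b ha h, map_sum]
    refine Finset.sum_congr rfl fun j hj => ?_
    have := Finset.mem_range.1 hj
    rw [map_smul, smul_eq_mul, hab, show n - (n - j) = j by omega]

/-- The Bullett–Macdonald form of the Adem relations. -/
theorem bullettMacdonald :
    scale₁ totalSq * scale₂ totalSq = scale₃ totalSq * scale₄ totalSq := by
  ext1 n
  simp only [coeff_mul, coeff_scaleSeries, totalSq, coeff_mk, one_pow, mul_one]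
  rw [Finset.Nat.sum_antidiagonal_eq_sum_range_succ_mk,
    Finset.Nat.sum_antidiagonal_eq_sum_range_succ_mk]
  refine (Eq.trans ?_ (sum_Sq_mul_Sq n)).trans ?_
  · refine Finset.sum_congr rfl fun a _ => ?_
    rw [map_mul, mul_assoc, ((commute_X_sq_add_X _).pow_left a).eq, mul_assoc]
  · refine Finset.sum_congr rfl fun a _ => ?_
    rw [map_mul, mul_assoc, mul_assoc, ← pow_mul, ← mul_assoc (Polynomial.C (Sq (n - a))),
      ← ((commute_one_add_X _).pow_left a).eq, mul_assoc]

/-- Coefficientwise this is the Adem relation `Sq^1 Sq^(k-1) = k Sq^k` modulo 2. -/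
theorem eulerDerivation_totalSq : eulerDerivation totalSq = X ^ 1 * C (Sq 1) * totalSq := by
  rw [pow_one]
  ext1 k
  rcases k with _ | k
  · simp [eulerDerivation, mul_assoc]
  · rw [mul_assoc, coeff_succ_X_mul, coeff_C_mul]
    simp only [eulerDerivation, totalSq, coeff_mk]
    rcases k with _ | k
    · simp [Sq_zero]
    · rw [Sq_mul_Sq 1 (k + 1) one_pos (by omega)]
      simp only [Nat.reduceDiv, zero_add, Finset.sum_range_one, mul_zero, Nat.sub_zero,
        Nat.add_sub_cancel, Nat.choose_one_right, Sq_zero, mul_one]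
      rw [Nat.cast_smul_eq_nsmul, add_comm 1, add_smul]
      simp [add_smul, add_assoc, ← two_mul, two_eq_zero]

/-- Frobenius; this supplies `c₁ + c₂ = c₃ + c₄` in `mul_commutator_mul_eq`, and is why the
exponents of `z` must be powers of 2. -/
theorem pow_add_one_eq (n : ℕ) :
    (Polynomial.X ^ 2 + Polynomial.X : Polynomial SteenrodAlgebra) ^ 2 ^ n + 1 ^ 2 ^ n =
      (1 + Polynomial.X) ^ 2 ^ n + (Polynomial.X ^ 2) ^ 2 ^ n := by
  have h : (Polynomial.X ^ 2 + Polynomial.X : Polynomial (ZMod 2)) ^ 2 ^ n + 1 ^ 2 ^ n =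
      (1 + Polynomial.X) ^ 2 ^ n + (Polynomial.X ^ 2) ^ 2 ^ n := by
    rw [add_pow_char_pow, add_pow_char_pow]
    ring
  simpa using congrArg (Polynomial.map (algebraMap (ZMod 2) SteenrodAlgebra)) h

theorem scale_commutator_of_derivation {N : ℕ} (q : SteenrodAlgebra) (n : ℕ) (hN : N = 2 ^ n)
    (h : scale₁ (X ^ N * C q * totalSq) * scale₂ totalSq +
        scale₁ totalSq * scale₂ (X ^ N * C q * totalSq) =
      scale₃ (X ^ N * C q * totalSq) * scale₄ totalSq +
        scale₃ totalSq * scale₄ (X ^ N * C q * totalSq)) :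
    scale₁ (totalSq * C q - C q * totalSq) * scale₂ totalSq =
      C (Polynomial.X ^ (2 * N)) * (scale₃ (totalSq * C q - C q * totalSq) * scale₄ totalSq) := by
  simp only [map_mul, scaleSeries_X_pow, scaleSeries_C] at h
  have hcomm {u : Polynomial SteenrodAlgebra} (hu : ∀ p, Commute u p) (w) :
      Commute (C (u ^ N) * X ^ N) w :=
    (commute_C_of_forall_commute (fun p => (hu p).pow_left N) w).mul_left
      ((commute_X w).symm.pow_left N)
  have key := mul_commutator_mul_eq (hcomm Commute.one_left) (hcomm commute_X_sq)
    bullettMacdonald h (by rw [← add_mul, ← add_mul, ← map_add, ← map_add, hN, pow_add_one_eq])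
  rw [← pow_mul] at key
  simp only [map_sub, map_mul, scaleSeries_C]
  refine X_pow_mul_cancel (k := N) ?_
  rw [one_pow, map_one, one_mul] at key
  rw [← mul_assoc, key, ← mul_assoc (X ^ N), ← (commute_X_pow _ _).eq]
  simp only [mul_assoc]

/-- Writing the commutator as `E * totalSq` and cancelling units leaves `E((s²+s)z) = s^(2N)
E((1+s)z)` with `N = 2^n`. For the coefficient `e` of `z^i` this says `e s^i (1+s)^i = e s^(2N)
(1+s)^i`, so `e = 0` unless `i = 2N`. -/
theorem totalSq_mul_Q_of_scale_commutator (n : ℕ)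
    (h : scale₁ (totalSq * C (Q n) - C (Q n) * totalSq) * scale₂ totalSq =
      C (Polynomial.X ^ (2 * 2 ^ n)) *
        (scale₃ (totalSq * C (Q n) - C (Q n) * totalSq) * scale₄ totalSq)) :
    totalSq * C (Q n) - C (Q n) * totalSq = X ^ 2 ^ (n + 1) * C (Q (n + 1)) * totalSq := by
  obtain ⟨E, hE⟩ : ∃ E, totalSq * C (Q n) - C (Q n) * totalSq = E * totalSq := by
    obtain ⟨v, hv⟩ := isUnit_totalSq
    exact ⟨(totalSq * C (Q n) - C (Q n) * totalSq) * ↑v⁻¹, by rw [← hv, Units.inv_mul_cancel_right]⟩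
  rw [hE, map_mul, map_mul, mul_assoc, mul_assoc (scale₃ E), ← bullettMacdonald, ← mul_assoc (C _)]
    at h
  have hE' := ((isUnit_totalSq.map scale₁).mul (isUnit_totalSq.map scale₂)).mul_right_cancel h
  have hcoeff : ∀ i, i ≠ 2 * 2 ^ n → coeff i E = 0 := by
    intro i hi
    have hi' := congrArg (coeff i) hE'
    rw [coeff_C_mul, coeff_scaleSeries, coeff_scaleSeries, ← mul_assoc, Polynomial.X_pow_mul,
      mul_assoc, show (Polynomial.X ^ 2 + Polynomial.X : Polynomial SteenrodAlgebra) =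
        Polynomial.X * (1 + Polynomial.X) by rw [mul_add, mul_one, add_comm, pow_two],
      (Polynomial.commute_X _).mul_pow] at hi'
    -- The lower of the exponents `i` and `2 * 2 ^ n` occurs on one side only, with coefficient
    -- `coeff i E`.
    rcases lt_or_gt_of_ne hi with hlt | hlt
    · have := congrArg (Polynomial.coeff · i) hi'
      simpa [Polynomial.coeff_C_mul, Polynomial.coeff_X_pow_mul', hlt.not_ge,
        Polynomial.coeff_one_add_X_pow] using this
    · have := congrArg (Polynomial.coeff · (2 * 2 ^ n)) hi'
      simpa [Polynomial.coeff_C_mul, Polynomial.coeff_X_pow_mul', hlt.not_ge,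
        Polynomial.coeff_one_add_X_pow, eq_comm] using this
  have hE₂ : E = X ^ 2 ^ (n + 1) * C (coeff (2 ^ (n + 1)) E) := by
    ext1 i
    rw [coeff_mul_C, coeff_X_pow]
    split_ifs with hi
    · rw [hi, one_mul]
    · rw [zero_mul, hcoeff i (by rwa [← pow_succ'])]
  have hQ : coeff (2 ^ (n + 1)) E = Q (n + 1) := by
    have := congrArg (coeff (2 ^ (n + 1))) hE
    rw [hE₂, mul_assoc, map_sub, coeff_mul_C, coeff_C_mul, coeff_X_pow_mul', if_pos le_rfl,
      coeff_C_mul, Nat.sub_self] at this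
    simp only [totalSq, coeff_mk, Sq_zero, mul_one] at this
    rw [← this, Q, sub_eq_add]
  rw [hE, ← hQ, ← hE₂]

theorem totalSq_commutator_Q (n : ℕ) :
    totalSq * C (Q n) - C (Q n) * totalSq = X ^ 2 ^ (n + 1) * C (Q (n + 1)) * totalSq := by
  induction n with
  | zero =>
    refine totalSq_mul_Q_of_scale_commutator 0 (scale_commutator_of_derivation _ 0 rfl ?_)
    rw [pow_zero, Q, ← eulerDerivation_totalSq]
    simp only [← eulerDerivation_scaleSeries]
    rw [← eulerDerivation_mul, ← eulerDerivation_mul, bullettMacdonald]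
  | succ n ih =>
    refine totalSq_mul_Q_of_scale_commutator (n + 1)
      (scale_commutator_of_derivation _ (n + 1) rfl ?_)
    rw [← ih]
    -- By the Leibniz rule each side telescopes to the commutator of a full product with `Q n`.
    simp only [map_sub, map_mul, scaleSeries_C, sub_mul, mul_sub, ← mul_assoc,
      sub_add_sub_cancel']
    rw [bullettMacdonald, mul_assoc (C _), bullettMacdonald, mul_assoc (C _)]

/-- Milnor's commutation formula `Sq^k Q_n + Q_n Sq^k = Q_{n+1} Sq^(k - 2^(n+1))`. -/
theorem Q_mul_Sq (n k : ℕ) : Q n * Sq k = Sq k * Q n +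
    if 2 ^ (n + 1) ≤ k then Q (n + 1) * Sq (k - 2 ^ (n + 1)) else 0 := by
  have h := congrArg (coeff k) (totalSq_commutator_Q n)
  rw [map_sub, coeff_mul_C, coeff_C_mul, mul_assoc, coeff_X_pow_mul', coeff_C_mul] at h
  simp only [totalSq, coeff_mk] at h
  rw [← h, ← sub_eq_add, sub_sub_cancel]

/-! ### The common kernel of the Milnor elements. -/

theorem Q_smul_Sq_smul_eq_zero {A : Type*} [AddCommGroup A] [Module SteenrodAlgebra A] {x : A}
    (hx : ∀ n, Q n • x = 0) (k : ℕ) : ∀ n, Q n • Sq k • x = 0 := by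
  -- The index `n` stays quantified, since the correction term involves `Q (n + 1)`.
  induction k using Nat.strong_induction_on with
  | _ k ih =>
    intro n
    rw [← mul_smul, Q_mul_Sq, add_smul, mul_smul, hx, smul_zero, zero_add]
    split_ifs with h
    · rw [mul_smul]
      exact ih _ (Nat.sub_lt_of_pos_le (by positivity) h) _
    · exact zero_smul _ _

theorem Q_mem_sqOneIdeal (n : ℕ) : Q n ∈ sqOneIdeal := by
  induction n with
  | zero => exact TwoSidedIdeal.subset_span rfl
  | succ n ih =>
    exact sqOneIdeal.add_mem (sqOneIdeal.mul_mem_left _ _ ih) (sqOneIdeal.mul_mem_right _ _ ih)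

theorem forall_Q_smul_eq_zero_iff {A : Type*} [AddCommGroup A] [Module SteenrodAlgebra A] (x : A) :
    (∀ i, Q i • x = 0) ↔ ∀ θ ∈ sqOneIdeal, θ • x = 0 := by
  refine ⟨fun hx θ hθ => ?_, fun h i => h _ (Q_mem_sqOneIdeal i)⟩
  let S : AddSubgroup A :=
    { carrier := {y | ∀ i, Q i • y = 0}
      zero_mem' := fun i => smul_zero _
      add_mem' := fun ha hb i => by rw [smul_add, ha i, hb i, add_zero]
      neg_mem' := fun ha i => by rw [smul_neg, ha i, neg_zero] }
  exact sqOneIdeal_smul_eq_zero S (fun k y hy => Q_smul_Sq_smul_eq_zero hy k) (fun y hy => hy 0)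
    θ hθ x hx

end SteenrodAlgebra

theorem mainTheorem4 {A : Type*} [CommRing A] [Algebra (ZMod 2) A]
    (𝒜 : ℕ → Submodule (ZMod 2) A) [GradedAlgebra 𝒜] [Module SteenrodAlgebra A]
    [IsUnstableAlgebra 𝒜] :
    (∀ (n : ℕ) (x : A), Even n → x ∈ 𝒜 n →
      (x ∈ tildeO 𝒜 ↔ ∀ i : ℕ, SteenrodAlgebra.Q i • x = 0)) ∧
    (∀ x : A, (∀ i : ℕ, SteenrodAlgebra.Q i • x = 0) ↔
      ∀ θ ∈ SteenrodAlgebra.sqOneIdeal, θ • x = 0) := by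
  refine ⟨fun n x hn hx => ?_, SteenrodAlgebra.forall_Q_smul_eq_zero_iff⟩
  rw [SteenrodAlgebra.forall_Q_smul_eq_zero_iff]
  refine ⟨fun h => h.2, fun h => ⟨?_, h⟩⟩
  obtain ⟨m, rfl⟩ := hn
  rw [← two_mul] at hx
  exact Submodule.mem_iSup_of_mem (p := fun n => 𝒜 (2 * n)) m hx
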